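/- There is an absolute constant $C>0$ such that the following holds for all positive integers $k$ and $n$. Call a collection $\{X_i\}_{i=1}^n$ of independent $\{0,1\}$-valued random variables *in $k$-heavy Binomial form* if there are $\ell\in\{0,1,\dots,n\}$ and $q\in\left\{\frac{1}{kn},\frac{2}{kn},\dots,\frac{kn-1}{kn}\right\}$ such that $\mathbf{E}[X_i]=q$ for all $i\le \ell$, $\mathbf{E}[X_i]\in\{0,1\}$ for all $i>\ell$, and $$\ell q\ \ge\ k^2-\frac1k,\qquad \ell q(1-q)\ \ge\ k^2-k-1-\frac3k .$$ Let $\{X_i\}_{i=1}^n$ and $\{Y_i\}_{i=1}^n$ be two such collections, both in $k$-heavy Binomial form (with possibly different $\ell$ and $q$), and put $X=\sum_{i=1}^n X_i$, $Y=\sum_{i=1}^n Y_i$. Then $$\tfrac12\, d_{\mathrm K}(X,Y)\ \le\ d_{\mathrm{TV}}(X,Y)\ \le\ 2\,d_{\mathrm K}(X,Y)+\frac{C}{k},$$ where $d_{\mathrm{TV}}(X,Y)=\frac12\sum_{a}|\Pr[X=a]-\Pr[Y=a]|$ is the total variation distance and $d_{\mathrm K}(X,Y)=\sup_{x\in\mathbb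 R}|\Pr[X\le x]-\Pr[Y\le x]|$ is the Kolmogorov distance. -/

import Mathlib

open MeasureTheory ProbabilityTheory

namespace PoissonBinomial

noncomputable section

/-- Total variation distance `(1/2) ∑ₐ |P(a) - Q(a)|` of two distributions on a countable
discrete domain. -/
def tvDist {α : Type*} [MeasurableSpace α] [MeasurableSingletonClass α] [Countable α]
    (P Q : Measure α) : ℝ :=
  (1 / 2 : ℝ) * ∑' a : α, |P.real {a} - Q.real {a}|

/-- Kolmogorov distance `sup_x |P((-∞, x]) - Q((-∞, x])|` of two distributions on `ℝ`. -/
def kolmogorovDist (P Q : Measure ℝ) : ℝ :=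
  ⨆ x : ℝ, |P.real (Set.Iic x) - Q.real (Set.Iic x)|

/-- Total variation distance of two `ℕ`-valued random variables, possibly defined on
different probability spaces: the distance between their laws. -/
def dTV {Ω Ω' : Type*} [MeasurableSpace Ω] [MeasurableSpace Ω'] (μ : Measure Ω) (X : Ω → ℕ)
    (ν : Measure Ω') (Y : Ω' → ℕ) : ℝ :=
  tvDist (μ.map X) (ν.map Y)

/-- Kolmogorov distance of two `ℕ`-valued random variables, regarded as real-valued: the
distance between their laws. -/
def dK {Ω Ω' : Type*} [MeasurableSpace Ω] [MeasurableSpace Ω'] (μ : Measure Ω) (X : Ω → ℕ)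
    (ν : Measure Ω') (Y : Ω' → ℕ) : ℝ :=
  kolmogorovDist (μ.map fun ω => (X ω : ℝ)) (ν.map fun ω => (Y ω : ℝ))

/-- `X₁, …, Xₙ` are independent `{0,1}`-valued random variables. -/
structure IndependentIndicators {Ω : Type*} [MeasurableSpace Ω] (μ : Measure Ω) {n : ℕ}
    (X : Fin n → Ω → ℕ) : Prop where
  measurable : ∀ i, Measurable (X i)
  zero_or_one : ∀ i ω, X i ω = 0 ∨ X i ω = 1
  indep : iIndepFun X μ

/-- The `k`-heavy Binomial form, as a condition on the vector `p` of means: for some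
`ℓ ∈ {0, …, n}` and `q ∈ {1/(kn), …, (kn-1)/(kn)}`, the first `ℓ` means are `q`, the others are
`0` or `1`, and `ℓ q ≥ k² - 1/k`, `ℓ q (1 - q) ≥ k² - k - 1 - 3/k`.
(The index `i : Fin n` stands for the index `i + 1` of `1, …, n`.) -/
def IsHeavyBinomialForm (k : ℕ) {n : ℕ} (p : Fin n → ℝ) : Prop :=
  ∃ (ℓ : ℕ) (q : ℝ), ℓ ≤ n ∧
    (∃ j : ℕ, 1 ≤ j ∧ j < k * n ∧ q = (j : ℝ) / ((k : ℝ) * (n : ℝ))) ∧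
    (∀ i : Fin n, (i : ℕ) < ℓ → p i = q) ∧
    (∀ i : Fin n, ℓ ≤ (i : ℕ) → p i = 0 ∨ p i = 1) ∧
    (k : ℝ) ^ 2 - 1 / (k : ℝ) ≤ (ℓ : ℝ) * q ∧
    (k : ℝ) ^ 2 - (k : ℝ) - 1 - 3 / (k : ℝ) ≤ (ℓ : ℝ) * q * (1 - q)

/-- A collection of independent indicators in `k`-heavy Binomial form. -/
structure HeavyBinomialCollection {Ω : Type*} [MeasurableSpace Ω] (μ : Measure Ω) (k : ℕ) {n : ℕ}
    (X : Fin n → Ω → ℕ) : Prop where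
  indicators : IndependentIndicators μ X
  heavy : IsHeavyBinomialForm k fun i => ∫ ω, (X i ω : ℝ) ∂μ

end

end PoissonBinomial

/-!
Let `W = ∑ i, X i` have mean `m = ∑ i, p i` and variance `v = ∑ i, p i * (1 - p i)`. Independence
gives `E[(X i - p i) g(W)] = p i E[(1 - X i) (g(W + 1) - g(W))]`; summed over `i`, this becomes
`E[(W - m) g(W)] = E[(v - D) (g(W + 1) - g(W))]`, where `D = ∑ i, p i * (X i - p i)` has variance at
most `v`. For the law of `s + Poisson(r)` with `s + r = m` and `r` within `1` of `v`, the solutions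
`g` of Stein's equation have increments at most `1 / r`, so `W` is within `O(1 / √v)` of this law in
total variation, whatever the means `p i` are.

Of two translated Poisson laws, the one translated further has a unimodal likelihood ratio to the
other, so it exceeds the other exactly on an interval. Their total variation distance is attained on
that interval, a difference of two half-lines, where two laws differ by at most twice their
Kolmogorov distance.
-/

namespace PoissonBinomial

/-! ### Total variation and Kolmogorov distance -/

section TotalVariation

variable {α : Type*} [MeasurableSpace α] [MeasurableSingletonClass α] [Countable α]

theorem hasSum_indicator_measureReal_singleton (P : Measure α) [IsFiniteMeasure P] (A : Set α) :
    HasSum (A.indicator fun a => P.real {a}) (P.real A) := by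
  have htop : ∑' a, A.indicator (fun a => P {a}) a ≠ ⊤ := by
    rw [P.tsum_indicator_apply_singleton A .of_discrete]
    exact measure_ne_top P A
  convert! ENNReal.hasSum_toReal htop using 1
  · ext a
    by_cases ha : a ∈ A <;> simp [ha, measureReal_def]
  · rw [← ENNReal.tsum_toReal_eq fun a => ENNReal.ne_top_of_tsum_ne_top htop a,
      P.tsum_indicator_apply_singleton A .of_discrete, measureReal_def]

theorem hasSum_indicator_measureReal_sub (P Q : Measure α) [IsFiniteMeasure P]
    [IsFiniteMeasure Q] (A : Set α) :
    HasSum (A.indicator fun a => P.real {a} - Q.real {a}) (P.real A - Q.real A) := by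
  convert! (hasSum_indicator_measureReal_singleton P A).sub
    (hasSum_indicator_measureReal_singleton Q A) using 1
  exact Set.indicator_sub' A _ _

theorem tvDist_comm (P Q : Measure α) : tvDist P Q = tvDist Q P := by
  simp only [tvDist, abs_sub_comm]

variable (P Q R : Measure α) [IsProbabilityMeasure P] [IsProbabilityMeasure Q]
  [IsProbabilityMeasure R]

theorem tvDist_eq_measureReal_sub :
    tvDist P Q = P.real {a | Q.real {a} < P.real {a}} - Q.real {a | Q.real {a} < P.real {a}} := by
  set S := {a | Q.real {a} < P.real {a}}
  -- The differences sum to zero, so twice their sum over `S` is the sum of their absolute values.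
  have hdiff := ((hasSum_indicator_measureReal_sub P Q S).mul_left 2).sub
    (hasSum_indicator_measureReal_sub P Q Set.univ)
  simp only [Set.indicator_univ, probReal_univ, sub_self, sub_zero] at hdiff
  have habs : ∀ a, |P.real {a} - Q.real {a}| =
      2 * S.indicator (fun a => P.real {a} - Q.real {a}) a - (P.real {a} - Q.real {a}) := by
    intro a
    by_cases ha : a ∈ S
    · rw [Set.indicator_of_mem ha, abs_of_pos (sub_pos.mpr ha)]
      ring
    · rw [Set.indicator_of_notMem ha, abs_of_nonpos (sub_nonpos.mpr (not_lt.mp ha))]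
      ring
  rw [tvDist, tsum_congr habs, hdiff.tsum_eq]
  ring

theorem measureReal_sub_le_tvDist (A : Set α) : P.real A - Q.real A ≤ tvDist P Q := by
  rw [tvDist_eq_measureReal_sub]
  set S := {a | Q.real {a} < P.real {a}}
  refine hasSum_le (fun a => ?_) (hasSum_indicator_measureReal_sub P Q A)
    (hasSum_indicator_measureReal_sub P Q S)
  by_cases ha : a ∈ S
  · rw [Set.indicator_of_mem ha]
    exact Set.indicator_apply_le' (fun _ => le_rfl) fun _ => (sub_pos.mpr ha).le
  · rw [Set.indicator_of_notMem ha]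
    exact Set.indicator_apply_nonpos fun _ => sub_nonpos.mpr (not_lt.mp ha)

theorem abs_measureReal_sub_le_tvDist (A : Set α) : |P.real A - Q.real A| ≤ tvDist P Q :=
  abs_sub_le_iff.mpr ⟨measureReal_sub_le_tvDist P Q A,
    (measureReal_sub_le_tvDist Q P A).trans_eq (tvDist_comm Q P)⟩

variable {P Q} in
theorem tvDist_le_of_forall_abs_measureReal_sub_le {d : ℝ}
    (h : ∀ A, |P.real A - Q.real A| ≤ d) : tvDist P Q ≤ d := by
  rw [tvDist_eq_measureReal_sub]
  exact (le_abs_self _).trans (h _)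

theorem tvDist_triangle : tvDist P R ≤ tvDist P Q + tvDist Q R :=
  tvDist_le_of_forall_abs_measureReal_sub_le fun A =>
    (abs_sub_le _ (Q.real A) _).trans
      (add_le_add (abs_measureReal_sub_le_tvDist P Q A) (abs_measureReal_sub_le_tvDist Q R A))

theorem tvDist_le_one : tvDist P Q ≤ 1 :=
  tvDist_le_of_forall_abs_measureReal_sub_le fun _ =>
    abs_sub_le_of_nonneg_of_le measureReal_nonneg measureReal_le_one measureReal_nonneg
      measureReal_le_one

end TotalVariation

theorem kolmogorovDist_nonneg (P Q : Measure ℝ) : 0 ≤ kolmogorovDist P Q :=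
  Real.iSup_nonneg fun _ => abs_nonneg _

/-- The Kolmogorov distance of two laws on `ℕ`, regarded as laws on `ℝ`. -/
noncomputable def natKolmogorovDist (P Q : Measure ℕ) : ℝ :=
  kolmogorovDist (P.map fun a : ℕ => (a : ℝ)) (Q.map fun a : ℕ => (a : ℝ))

theorem natKolmogorovDist_eq_iSup (P Q : Measure ℕ) :
    natKolmogorovDist P Q =
      ⨆ x : ℝ, |P.real {a : ℕ | (a : ℝ) ≤ x} - Q.real {a : ℕ | (a : ℝ) ≤ x}| := by
  simp only [natKolmogorovDist, kolmogorovDist,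
    map_measureReal_apply .of_discrete measurableSet_Iic]
  rfl

theorem dK_eq_natKolmogorovDist {Ω Ω' : Type*} [MeasurableSpace Ω] [MeasurableSpace Ω']
    (μ : Measure Ω) (ν : Measure Ω') {X : Ω → ℕ} {Y : Ω' → ℕ} (hX : Measurable X)
    (hY : Measurable Y) : dK μ X ν Y = natKolmogorovDist (μ.map X) (ν.map Y) := by
  rw [natKolmogorovDist, Measure.map_map .of_discrete hX, Measure.map_map .of_discrete hY]
  rfl

section Kolmogorov

variable (P Q : Measure ℕ) [IsProbabilityMeasure P] [IsProbabilityMeasure Q]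

theorem natKolmogorovDist_le_tvDist : natKolmogorovDist P Q ≤ tvDist P Q := by
  rw [natKolmogorovDist_eq_iSup]
  exact ciSup_le fun x => abs_measureReal_sub_le_tvDist P Q _

variable {L A : Set ℕ}

theorem abs_measureReal_sub_le_natKolmogorovDist_of_isLowerSet (hL : IsLowerSet L) :
    |P.real L - Q.real L| ≤ natKolmogorovDist P Q := by
  rcases hL.eq_univ_or_Iio with rfl | ⟨b, rfl⟩
  · rw [probReal_univ, probReal_univ, sub_self, abs_zero]
    exact kolmogorovDist_nonneg _ _
  · have hbdd : BddAbove (Set.range fun x : ℝ =>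
        |P.real {a : ℕ | (a : ℝ) ≤ x} - Q.real {a : ℕ | (a : ℝ) ≤ x}|) :=
      ⟨tvDist P Q, by rintro _ ⟨x, rfl⟩; exact abs_measureReal_sub_le_tvDist P Q _⟩
    have hIio : Set.Iio b = {a : ℕ | (a : ℝ) ≤ (b : ℝ) - 1} := by
      ext a
      change a < b ↔ (a : ℝ) ≤ b - 1
      rw [le_sub_iff_add_le]
      exact_mod_cast Nat.lt_iff_add_one_le
    rw [natKolmogorovDist_eq_iSup, hIio]
    exact le_ciSup hbdd ((b : ℝ) - 1)

theorem abs_measureReal_sub_le_two_mul_natKolmogorovDist_of_ordConnected (hA : A.OrdConnected) :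
    |P.real A - Q.real A| ≤ 2 * natKolmogorovDist P Q := by
  set L : Set ℕ := ↑(lowerClosure A)
  have hAL : A ⊆ L := subset_lowerClosure
  have hL : IsLowerSet L := (lowerClosure A).lower
  have hLA : IsLowerSet (L \ A) := by
    rintro a b hba ⟨haL, haA⟩
    obtain ⟨c, hc, hac⟩ := mem_lowerClosure.mp haL
    exact ⟨hL hba haL, fun hb => haA (hA.out hb hc ⟨hba, hac⟩)⟩
  calc |P.real A - Q.real A| =
        |(P.real L - Q.real L) - (P.real (L \ A) - Q.real (L \ A))| := by
        rw [measureReal_sdiff hAL .of_discrete, measureReal_sdiff hAL .of_discrete]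
        ring_nf
    _ ≤ |P.real L - Q.real L| + |P.real (L \ A) - Q.real (L \ A)| := abs_sub _ _
    _ ≤ natKolmogorovDist P Q + natKolmogorovDist P Q := add_le_add
        (abs_measureReal_sub_le_natKolmogorovDist_of_isLowerSet P Q hL)
        (abs_measureReal_sub_le_natKolmogorovDist_of_isLowerSet P Q hLA)
    _ = 2 * natKolmogorovDist P Q := (two_mul _).symm

end Kolmogorov

/-! ### The Stein equation of a Poisson law -/

section Poisson

theorem abs_indicator_one_sub_measureReal_le_one {α : Type*} [MeasurableSpace α] (P : Measure α)
    [IsProbabilityMeasure P] (A B : Set α) (a : α) :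
    |A.indicator (fun _ => (1 : ℝ)) a - P.real B| ≤ 1 :=
  abs_sub_le_of_nonneg_of_le (Set.indicator_nonneg (fun _ _ => zero_le_one) a)
    (Set.indicator_apply_le' (fun _ => le_rfl) fun _ => zero_le_one) measureReal_nonneg
    measureReal_le_one

theorem measureReal_inter_Iic_succ (P : Measure ℕ) [IsFiniteMeasure P] (A : Set ℕ) (v : ℕ) :
    P.real (A ∩ Set.Iic (v + 1)) = P.real (A ∩ Set.Iic v) + P.real (A ∩ {v + 1}) := by
  rw [← measureReal_union ?_ .of_discrete, ← Set.inter_union_distrib_left, Set.union_singleton,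
    ← Nat.succ_eq_add_one, ← Nat.succ_eq_succ, Order.Iic_succ]
  · rw [Set.disjoint_left]
    rintro a ⟨-, ha⟩ ⟨-, rfl⟩
    exact absurd ha (Nat.not_succ_le_self v)

theorem measureReal_inter_Iic_add_inter_Ioi (P : Measure ℕ) [IsFiniteMeasure P] (A : Set ℕ)
    (v : ℕ) : P.real (A ∩ Set.Iic v) + P.real (A ∩ Set.Ioi v) = P.real A := by
  rw [← Set.compl_Iic, ← Set.sdiff_eq]
  exact measureReal_inter_add_sdiff .of_discrete

theorem measureReal_inter_singleton (P : Measure ℕ) (A : Set ℕ) (a : ℕ) :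
    P.real (A ∩ {a}) = A.indicator (fun _ => (1 : ℝ)) a * P.real {a} := by
  by_cases ha : a ∈ A <;> simp [ha]

variable (r : NNReal)

theorem succ_mul_poissonMeasure_real_singleton_succ (j : ℕ) :
    ((j : ℝ) + 1) * (poissonMeasure r).real {j + 1} = r * (poissonMeasure r).real {j} := by
  simp only [poissonMeasure_real_singleton, Nat.factorial_succ, pow_succ]
  push_cast
  field_simp

theorem mul_poissonMeasure_preimage_succ (A : Set ℕ) :
    r * poissonMeasure r (Nat.succ ⁻¹' A) = ∫⁻ a in A, a ∂poissonMeasure r := by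
  have hlaw : (r : ENNReal) • (poissonMeasure r).map Nat.succ =
      (poissonMeasure r).withDensity fun a => (a : ENNReal) := by
    refine Measure.ext_of_singleton fun a => ?_
    rw [Measure.smul_apply, Measure.map_apply .of_discrete .of_discrete,
      withDensity_apply _ .of_discrete, lintegral_singleton, smul_eq_mul]
    cases a with
    | zero => simp [Set.preimage]
    | succ j =>
      have hpre : Nat.succ ⁻¹' {j + 1} = {j} := by
        ext i
        simp
      rw [hpre, ← ENNReal.toReal_eq_toReal_iff' (by finiteness) (by finiteness)]
      rw [ENNReal.toReal_mul, ENNReal.toReal_mul, ENNReal.toReal_natCast, Nat.cast_add_one]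
      exact (succ_mul_poissonMeasure_real_singleton_succ r j).symm
  have hA := congrArg (fun ρ : Measure ℕ => ρ A) hlaw
  rwa [Measure.smul_apply, Measure.map_apply .of_discrete .of_discrete,
    withDensity_apply _ .of_discrete, smul_eq_mul] at hA

theorem mul_poissonMeasure_real_Iic_le (v : ℕ) :
    r * (poissonMeasure r).real (Set.Iic v) ≤
      ((v : ℝ) + 1) * (poissonMeasure r).real (Set.Iic (v + 1)) := by
  have hpre : Nat.succ ⁻¹' Set.Iic (v + 1) = Set.Iic v := by
    ext i
    simp
  have hle : r * poissonMeasure r (Set.Iic v) ≤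
      ((v + 1 : ℕ) : ENNReal) * poissonMeasure r (Set.Iic (v + 1)) := by
    rw [← hpre, mul_poissonMeasure_preimage_succ, ← setLIntegral_const]
    exact setLIntegral_mono .of_discrete fun a ha => Nat.cast_le.mpr ha
  rw [← Nat.cast_add_one]
  simpa only [measureReal_def, ENNReal.toReal_mul, ENNReal.toReal_natCast, ENNReal.coe_toReal]
    using ENNReal.toReal_mono (by finiteness) hle

theorem mul_poissonMeasure_real_Ioi_succ_le (v : ℕ) :
    ((v : ℝ) + 1) * (poissonMeasure r).real (Set.Ioi (v + 1)) ≤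
      r * (poissonMeasure r).real (Set.Ioi v) := by
  have hpre : Nat.succ ⁻¹' Set.Ioi (v + 1) = Set.Ioi v := by
    ext i
    simp
  have hle : ((v + 1 : ℕ) : ENNReal) * poissonMeasure r (Set.Ioi (v + 1)) ≤
      r * poissonMeasure r (Set.Ioi v) := by
    rw [← hpre, mul_poissonMeasure_preimage_succ, ← setLIntegral_const]
    exact setLIntegral_mono .of_discrete fun a ha => Nat.cast_le.mpr (le_of_lt ha)
  rw [← Nat.cast_add_one]
  simpa only [measureReal_def, ENNReal.toReal_mul, ENNReal.toReal_natCast, ENNReal.coe_toReal]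
    using ENNReal.toReal_mono (by finiteness) hle

/-- The solution `g` of the Stein equation `r g(a + 1) - a g(a) = 1_A(a) - P(A)` of the Poisson law
`P` with mean `r`. The equation leaves `g(0)` free; the truncated subtraction makes it equal to
`g(1)`. -/
noncomputable def steinSolution (A : Set ℕ) (a : ℕ) : ℝ :=
  ((poissonMeasure r).real (A ∩ Set.Iic (a - 1)) -
      (poissonMeasure r).real A * (poissonMeasure r).real (Set.Iic (a - 1))) /
    (r * (poissonMeasure r).real {a - 1})

theorem steinSolution_compl (A : Set ℕ) (a : ℕ) :
    steinSolution r Aᶜ a = -steinSolution r A a := by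
  have hsplit := measureReal_inter_add_sdiff (μ := poissonMeasure r) (s := Set.Iic (a - 1))
    (t := A) .of_discrete
  rw [Set.sdiff_eq, Set.inter_comm, Set.inter_comm _ Aᶜ] at hsplit
  rw [steinSolution, steinSolution, probReal_compl_eq_one_sub .of_discrete, ← neg_div]
  congr 1
  linear_combination hsplit

variable {r} (hr : 0 < r) (A : Set ℕ)
include hr

theorem mul_steinSolution_one :
    r * steinSolution r A 1 = A.indicator (fun _ => (1 : ℝ)) 0 - (poissonMeasure r).real A := by
  have hr' : (r : ℝ) ≠ 0 := by exact_mod_cast hr.ne'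
  have hatom := (poissonMeasure_real_singleton_pos 0 hr).ne'
  have hIic : Set.Iic 0 = ({0} : Set ℕ) := Set.Iic_bot
  rw [steinSolution, Nat.sub_self, hIic, measureReal_inter_singleton]
  field_simp

theorem steinSolution_equation (a : ℕ) :
    r * steinSolution r A (a + 1) - a * steinSolution r A a =
      A.indicator (fun _ => (1 : ℝ)) a - (poissonMeasure r).real A := by
  cases a with
  | zero => simpa using mul_steinSolution_one hr A
  | succ v =>
    have hr' : (r : ℝ) ≠ 0 := by exact_mod_cast hr.ne'
    have := (poissonMeasure_real_singleton_pos v hr).ne'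
    have hsucc := (poissonMeasure_real_singleton_pos (v + 1) hr).ne'
    have hIic := measureReal_inter_Iic_succ (poissonMeasure r) Set.univ v
    simp only [Set.univ_inter] at hIic
    simp only [steinSolution, Nat.add_sub_cancel, measureReal_inter_Iic_succ,
      measureReal_inter_singleton, hIic]
    rw [← succ_mul_poissonMeasure_real_singleton_succ r v]
    push_cast
    field_simp
    ring

theorem abs_steinSolution_one_le : |steinSolution r A 1| ≤ 1 / r := by
  have hr' : (0 : ℝ) < r := by exact_mod_cast hr
  rw [le_div_iff₀' hr']
  nth_rw 1 [← abs_of_pos hr', ← abs_mul, mul_steinSolution_one hr]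
  exact abs_indicator_one_sub_measureReal_le_one _ A A 0

omit hr in
theorem poissonMeasure_centered_Iic_increment_le (v : ℕ) :
    ((v : ℝ) + 1) * ((poissonMeasure r).real (A ∩ Set.Iic (v + 1)) -
        (poissonMeasure r).real A * (poissonMeasure r).real (Set.Iic (v + 1))) -
      r * ((poissonMeasure r).real (A ∩ Set.Iic v) -
        (poissonMeasure r).real A * (poissonMeasure r).real (Set.Iic v)) ≤
      ((v : ℝ) + 1) * (poissonMeasure r).real {v + 1} := by
  set P := poissonMeasure r
  have hlower := mul_poissonMeasure_real_Iic_le r v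
  have hupper := mul_poissonMeasure_real_Ioi_succ_le r v
  have hIoi := measureReal_inter_Iic_add_inter_Ioi P Set.univ v
  have hIoi_succ := measureReal_inter_Iic_add_inter_Ioi P Set.univ (v + 1)
  simp only [Set.univ_inter, probReal_univ] at hIoi hIoi_succ
  -- The left side is additive in `A`; only the part of `A` at `v + 1` contributes positively.
  have hbelow : 0 ≤ P.real (A ∩ Set.Iic v) *
      (r * P.real (Set.Ioi v) - (v + 1) * P.real (Set.Ioi (v + 1))) :=
    mul_nonneg measureReal_nonneg (sub_nonneg.mpr hupper)
  have habove : 0 ≤ P.real (A ∩ Set.Ioi (v + 1)) *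
      ((v + 1) * P.real (Set.Iic (v + 1)) - r * P.real (Set.Iic v)) :=
    mul_nonneg measureReal_nonneg (sub_nonneg.mpr hlower)
  have hatom : P.real (A ∩ {v + 1}) *
      ((v + 1) * P.real (Set.Ioi (v + 1)) + r * P.real (Set.Iic v)) ≤
        P.real {v + 1} * (v + 1) :=
    mul_le_mul (measureReal_mono Set.inter_subset_right)
      (by linear_combination hlower + ((v : ℝ) + 1) * hIoi_succ) (by positivity) measureReal_nonneg
  have hA : P.real A =
      P.real (A ∩ Set.Iic v) + P.real (A ∩ {v + 1}) + P.real (A ∩ Set.Ioi (v + 1)) := by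
    rw [← measureReal_inter_Iic_succ, measureReal_inter_Iic_add_inter_Ioi]
  rw [measureReal_inter_Iic_succ, hA]
  linear_combination hbelow + habove + hatom -
    ((v : ℝ) + 1) * (P.real (A ∩ Set.Iic v) + P.real (A ∩ {v + 1})) * hIoi_succ +
    r * P.real (A ∩ Set.Iic v) * hIoi

theorem steinSolution_succ_succ_sub_le (v : ℕ) :
    steinSolution r A (v + 2) - steinSolution r A (v + 1) ≤ 1 / r := by
  have : (0 : ℝ) < r := by exact_mod_cast hr
  have hatom := poissonMeasure_real_singleton_pos (v + 1) hr
  have hincr := poissonMeasure_centered_Iic_increment_le (r := r) A v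
  simp only [steinSolution, Nat.add_sub_cancel, show v + 2 - 1 = v + 1 from rfl]
  rw [← succ_mul_poissonMeasure_real_singleton_succ r v]
  generalize (poissonMeasure r).real (A ∩ Set.Iic (v + 1)) - _ = N' at *
  generalize (poissonMeasure r).real (A ∩ Set.Iic v) - _ = N at *
  set b := (poissonMeasure r).real {v + 1}
  calc N' / (r * b) - N / (((v : ℝ) + 1) * b)
      = (((v : ℝ) + 1) * N' - r * N) / (r * (((v : ℝ) + 1) * b)) := by field_simp
    _ ≤ (((v : ℝ) + 1) * b) / (r * (((v : ℝ) + 1) * b)) := by gcongr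
    _ = 1 / r := by field_simp

theorem abs_steinSolution_succ_sub_le (a : ℕ) :
    |steinSolution r A (a + 1) - steinSolution r A a| ≤ 1 / r := by
  cases a with
  | zero =>
    have hzero : steinSolution r A 1 = steinSolution r A 0 := rfl
    simp [hzero]
  | succ v =>
    have hcompl := steinSolution_succ_succ_sub_le hr Aᶜ v
    rw [steinSolution_compl, steinSolution_compl] at hcompl
    exact abs_sub_le_iff.mpr ⟨steinSolution_succ_succ_sub_le hr A v, by linarith⟩

end Poisson

/-! ### Translated Poisson laws -/

section RatioComparison

variable {p p' α α' : ℕ → ℝ} {s : ℕ} (hp : ∀ a, 0 ≤ p a)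
  (hα' : ∀ a, s ≤ a → 0 ≤ α' a)
  (hsucc : ∀ a, s ≤ a → p (a + 1) = α a * p a) (hsucc' : ∀ a, s ≤ a → p' (a + 1) = α' a * p' a)
  (hratio : ∀ a, s ≤ a → α a ≤ α' a → α (a + 1) ≤ α' (a + 1))
include hp hα' hsucc hsucc' hratio

theorem forall_le_of_ratio_le {a : ℕ} (hsa : s ≤ a) (ha : p a ≤ p' a) (hαa : α a ≤ α' a) :
    ∀ b, a ≤ b → p b ≤ p' b := by
  suffices h : ∀ b, a ≤ b → p b ≤ p' b ∧ α b ≤ α' b from fun b hb => (h b hb).1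
  intro b hb
  induction b, hb using Nat.le_induction with
  | base => exact ⟨ha, hαa⟩
  | succ b hab ih =>
    have hsb := hsa.trans hab
    refine ⟨?_, hratio b hsb ih.2⟩
    rw [hsucc b hsb, hsucc' b hsb]
    exact mul_le_mul ih.2 ih.1 (hp b) (hα' b hsb)

theorem ordConnected_setOf_lt_of_ratio (hp' : ∀ a, 0 ≤ p' a) (hlow : ∀ a < s, p a ≤ p' a) :
    {a | p' a < p a}.OrdConnected := by
  refine ⟨?_⟩
  rintro x hx z hz y ⟨hxy, hyz⟩
  have hdichotomy : p' y < p y ∨ ∀ b, y ≤ b → p b ≤ p' b := by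
    clear hyz
    induction y, hxy using Nat.le_induction with
    | base => exact .inl hx
    | succ y _ ih =>
      rcases ih with hy | hy
      swap
      · exact .inr fun b hb => hy b (Nat.le_of_succ_le hb)
      rcases lt_or_ge (p' (y + 1)) (p (y + 1)) with hlt | hle
      · exact .inl hlt
      have hsy : s ≤ y := not_lt.mp fun h => (hlow y h).not_gt hy
      rcases le_or_gt (α y) (α' y) with hα | hα
      · exact .inr (forall_le_of_ratio_le hp hα' hsucc hsucc' hratio (hsy.trans y.le_succ) hle
          (hratio y hsy hα))
      · refine absurd hle (not_le.mpr ?_)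
        rw [hsucc y hsy, hsucc' y hsy]
        exact (mul_le_mul_of_nonneg_left hy.le (hα' y hsy)).trans_lt
          (mul_lt_mul_of_pos_right hα ((hp' y).trans_lt hy))
  exact hdichotomy.resolve_right fun h => (h z hyz).not_gt hz

end RatioComparison

/-- The law of `s + N`, where `N` has the Poisson law with mean `r`. With `s` and `r` both free, it
can match the mean and, up to rounding, the variance of a sum of independent indicators. -/
noncomputable def translatedPoisson (s : ℕ) (r : NNReal) : Measure ℕ :=
  (poissonMeasure r).map fun j => s + j

instance (s : ℕ) (r : NNReal) : IsProbabilityMeasure (translatedPoisson s r) :=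
  Measure.isProbabilityMeasure_map .of_discrete

theorem translatedPoisson_real_apply (s : ℕ) (r : NNReal) (A : Set ℕ) :
    (translatedPoisson s r).real A = (poissonMeasure r).real {j | s + j ∈ A} :=
  map_measureReal_apply .of_discrete .of_discrete

theorem translatedPoisson_real_singleton_of_lt {s a : ℕ} (r : NNReal) (h : a < s) :
    (translatedPoisson s r).real {a} = 0 := by
  have hempty : {j | s + j ∈ ({a} : Set ℕ)} = ∅ :=
    Set.eq_empty_of_forall_notMem fun j hj => (h.trans_le (Nat.le_add_right s j)).ne' hj
  rw [translatedPoisson_real_apply, hempty, measureReal_empty]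

theorem translatedPoisson_real_singleton_add (s j : ℕ) (r : NNReal) :
    (translatedPoisson s r).real {s + j} = (poissonMeasure r).real {j} := by
  have hsingleton : {i | s + i ∈ ({s + j} : Set ℕ)} = {j} := by
    ext i
    exact Nat.add_left_cancel_iff
  rw [translatedPoisson_real_apply, hsingleton]

theorem translatedPoisson_real_singleton_succ {s a : ℕ} (r : NNReal) (h : s ≤ a) :
    (translatedPoisson s r).real {a + 1} =
      r / ((a : ℝ) + 1 - s) * (translatedPoisson s r).real {a} := by
  obtain ⟨j, rfl⟩ := Nat.exists_eq_add_of_le h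
  have hpos : (0 : ℝ) < j + 1 := by positivity
  rw [add_assoc, translatedPoisson_real_singleton_add, translatedPoisson_real_singleton_add,
    show ((s + j : ℕ) : ℝ) + 1 - s = j + 1 by push_cast; ring, div_mul_eq_mul_div,
    eq_div_iff hpos.ne', mul_comm, succ_mul_poissonMeasure_real_singleton_succ]

theorem ordConnected_setOf_translatedPoisson_lt {s t : ℕ} (r u : NNReal) (hts : t ≤ s) :
    {a | (translatedPoisson t u).real {a} < (translatedPoisson s r).real {a}}.OrdConnected := by
  have hts' : (t : ℝ) ≤ s := Nat.cast_le.mpr hts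
  have hpos : ∀ a : ℕ, s ≤ a → (0 : ℝ) < a + 1 - s := fun a ha => by
    linarith [(Nat.cast_le (α := ℝ)).mpr ha]
  refine ordConnected_setOf_lt_of_ratio (s := s) (α := fun a => r / ((a : ℝ) + 1 - s))
    (α' := fun a => u / ((a : ℝ) + 1 - t)) (fun _ => measureReal_nonneg)
    (fun a ha => div_nonneg u.2 (by linarith [hpos a ha]))
    (fun a ha => translatedPoisson_real_singleton_succ r ha)
    (fun a ha => translatedPoisson_real_singleton_succ u (hts.trans ha)) (fun a ha hle => ?_)
    (fun _ => measureReal_nonneg)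
    fun a ha => (translatedPoisson_real_singleton_of_lt r ha).trans_le measureReal_nonneg
  have hs := hpos a ha
  have ht : (0 : ℝ) < a + 1 - t := by linarith
  rw [div_le_div_iff₀ hs ht] at hle
  have hru : (r : ℝ) ≤ u := le_of_mul_le_mul_right
    (hle.trans' (mul_le_mul_of_nonneg_left (by linarith) r.2)) hs
  push_cast
  rw [div_le_div_iff₀ (by linarith) (by linarith)]
  linarith

theorem exists_ordConnected_tvDist_translatedPoisson_eq (s t : ℕ) (r u : NNReal) :
    ∃ A : Set ℕ, A.OrdConnected ∧ tvDist (translatedPoisson s r) (translatedPoisson t u) =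
      |(translatedPoisson s r).real A - (translatedPoisson t u).real A| := by
  wlog hts : t ≤ s generalizing s t r u
  · obtain ⟨A, hA, hAdist⟩ := this t s u r (not_le.mp hts).le
    exact ⟨A, hA, by rw [tvDist_comm, hAdist, abs_sub_comm]⟩
  · refine ⟨_, ordConnected_setOf_translatedPoisson_lt r u hts, ?_⟩
    rw [← tvDist_eq_measureReal_sub, abs_of_nonneg]
    exact (abs_nonneg _).trans (abs_measureReal_sub_le_tvDist _ _ ∅)

theorem tvDist_le_two_mul_natKolmogorovDist_add (P Q : Measure ℕ) [IsProbabilityMeasure P]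
    [IsProbabilityMeasure Q] (s t : ℕ) (r u : NNReal) :
    tvDist P Q ≤ 2 * natKolmogorovDist P Q + 2 * tvDist P (translatedPoisson s r) +
      2 * tvDist Q (translatedPoisson t u) := by
  set P' := translatedPoisson s r
  set Q' := translatedPoisson t u
  obtain ⟨A, hA, hAdist⟩ := exists_ordConnected_tvDist_translatedPoisson_eq s t r u
  have hPA := abs_measureReal_sub_le_tvDist P P' A
  have hQA := abs_measureReal_sub_le_tvDist Q Q' A
  have hPQA := abs_measureReal_sub_le_two_mul_natKolmogorovDist_of_ordConnected P Q hA
  have hPQ' : tvDist P' Q' ≤ tvDist P P' + 2 * natKolmogorovDist P Q + tvDist Q Q' := calc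
    tvDist P' Q' = |P'.real A - Q'.real A| := hAdist
    _ ≤ |P'.real A - P.real A| + |P.real A - Q'.real A| := abs_sub_le _ _ _
    _ ≤ |P'.real A - P.real A| + (|P.real A - Q.real A| + |Q.real A - Q'.real A|) := by
      gcongr
      exact abs_sub_le _ _ _
    _ ≤ tvDist P P' + 2 * natKolmogorovDist P Q + tvDist Q Q' := by
      rw [abs_sub_comm (P'.real A)]
      linarith
  calc tvDist P Q ≤ tvDist P P' + tvDist P' Q := tvDist_triangle P P' Q
    _ ≤ tvDist P P' + (tvDist P' Q' + tvDist Q' Q) := by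
      gcongr
      exact tvDist_triangle P' Q' Q
    _ ≤ 2 * natKolmogorovDist P Q + 2 * tvDist P P' + 2 * tvDist Q Q' := by
      rw [tvDist_comm Q']
      linarith

theorem abs_sub_mul_steinSolution_zero_le {r : NNReal} (hr : 0 < r) (A : Set ℕ) {b x : ℝ}
    (hb : |b| ≤ 1) (hx : 1 ≤ x) : |b - r * x * steinSolution r A 0| ≤ 2 * x ^ 2 := by
  have hr' : (0 : ℝ) < r := by exact_mod_cast hr
  have hx0 : 0 ≤ x := zero_le_one.trans hx
  have hzero : |steinSolution r A 0| ≤ 1 / r := abs_steinSolution_one_le hr A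
  calc |b - r * x * steinSolution r A 0| ≤ |b| + |r * x * steinSolution r A 0| := abs_sub _ _
    _ = |b| + r * x * |steinSolution r A 0| := by
      rw [abs_mul, abs_of_nonneg (mul_nonneg hr'.le hx0)]
    _ ≤ 1 + r * x * (1 / r) := by gcongr
    _ = 1 + x := by field_simp
    _ ≤ 2 * x ^ 2 := by nlinarith

theorem exists_translatedPoisson_stein_solution {r : NNReal} (hr : 0 < r) (s : ℕ) (A : Set ℕ) :
    ∃ g : ℕ → ℝ, (∀ a, |g (a + 1) - g a| ≤ 1 / r) ∧
      ∀ a : ℕ, |(A.indicator (fun _ => (1 : ℝ)) a - (translatedPoisson s r).real A) -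
        (r * (g (a + 1) - g a) - ((a : ℝ) - (s + r)) * g a)| ≤
          2 * (((a : ℝ) - (s + r)) / r) ^ 2 := by
  set B : Set ℕ := {j | s + j ∈ A}
  have hr' : (0 : ℝ) < r := by exact_mod_cast hr
  refine ⟨fun a => steinSolution r B (a - s), fun a => ?_, fun a => ?_⟩
  · dsimp only
    rcases le_or_gt s a with hsa | has
    · rw [Nat.sub_add_comm hsa]
      exact abs_steinSolution_succ_sub_le hr B (a - s)
    · simp [Nat.sub_eq_zero_of_le has, Nat.sub_eq_zero_of_le has.le]
  · dsimp only
    rw [translatedPoisson_real_apply]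
    rcases le_or_gt s a with hsa | has
    · obtain ⟨j, rfl⟩ := Nat.exists_eq_add_of_le hsa
      have hzero := steinSolution_equation hr B j
      have hmem : A.indicator (fun _ => (1 : ℝ)) (s + j) = B.indicator (fun _ => (1 : ℝ)) j := rfl
      have hcancel : B.indicator (fun _ => (1 : ℝ)) j - (poissonMeasure r).real B -
          (r * (steinSolution r B (j + 1) - steinSolution r B j) -
            (((s + j : ℕ) : ℝ) - (s + r)) * steinSolution r B j) = 0 := by
        push_cast
        linear_combination -hzero
      rw [Nat.sub_add_comm hsa, Nat.add_sub_cancel_left, hmem, hcancel, abs_zero]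
      positivity
    · -- Below `s` the equation fails, but there the distance to the mean exceeds `r`.
      set x := ((s : ℝ) + r - a) / r with hx
      have hx1 : 1 ≤ x := by
        rw [hx, one_le_div hr']
        linarith [(Nat.cast_lt (α := ℝ)).mpr has]
      have hrx : r * x = (s : ℝ) + r - a := mul_div_cancel₀ _ hr'.ne'
      rw [Nat.sub_eq_zero_of_le has, Nat.sub_eq_zero_of_le has.le]
      convert! abs_sub_mul_steinSolution_zero_le hr B
        (abs_indicator_one_sub_measureReal_le_one (poissonMeasure r) A B a) hx1 using 1
      · congr 1
        linear_combination steinSolution r B 0 * hrx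
      · rw [hx]
        ring

/-! ### Sums of independent indicators -/

theorem integral_abs_sub_integral_le_sqrt_variance {Ω : Type*} [MeasurableSpace Ω]
    {μ : Measure Ω} [IsProbabilityMeasure μ] {S : Ω → ℝ} (hS : MemLp S 2 μ) :
    ∫ ω, |S ω - ∫ ω', S ω' ∂μ| ∂μ ≤ √Var[S; μ] := by
  have hdev : MemLp (fun ω => |S ω - ∫ ω', S ω' ∂μ|) 2 μ := (hS.sub (memLp_const _)).abs
  refine Real.le_sqrt_of_sq_le ?_
  have hvar := variance_nonneg (fun ω => |S ω - ∫ ω', S ω' ∂μ|) μ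
  rw [variance_eq_sub hdev, sub_nonneg] at hvar
  simpa only [Pi.pow_apply, sq_abs, variance_eq_integral hS.aemeasurable] using hvar

theorem one_add_sqrt_div_add_le {v : ℝ} (hv : 1 ≤ v) :
    (1 + √v) / v + 2 * v / v ^ 2 ≤ 6 / √(1 + v) := by
  have ht : 1 ≤ √v := Real.one_le_sqrt.mpr hv
  have hsqrt : √(1 + v) ≤ 3 / 2 * √v := by
    rw [Real.sqrt_le_left (by positivity), mul_pow, Real.sq_sqrt (by linarith)]
    linarith
  calc (1 + √v) / v + 2 * v / v ^ 2 = (√v + 3) / √v ^ 2 := by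
        rw [Real.sq_sqrt (by linarith)]
        field_simp
        ring
    _ ≤ (√v + 3 * √v) / √v ^ 2 := by gcongr; linarith
    _ = 6 / (3 / 2 * √v) := by field_simp; ring
    _ ≤ 6 / √(1 + v) := by gcongr

namespace IndependentIndicators

variable {Ω : Type*} [MeasurableSpace Ω] {μ : Measure Ω} {n : ℕ} {X : Fin n → Ω → ℕ}

theorem measurable_sum (hX : IndependentIndicators μ X) : Measurable fun ω => ∑ i, X i ω :=
  Finset.measurable_sum _ fun i _ => hX.measurable i

variable [IsProbabilityMeasure μ]

theorem integrable_comp (hX : IndependentIndicators μ X) (φ : (Fin n → ℕ) → ℝ) :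
    Integrable (fun ω => φ fun i => X i ω) μ := by
  have hmeas : Measurable fun ω => (fun i => X i ω) := measurable_pi_lambda _ hX.measurable
  refine Integrable.of_bound (Measurable.of_discrete.comp hmeas).aestronglyMeasurable
    (∑ y ∈ Fintype.piFinset fun _ : Fin n => ({0, 1} : Finset ℕ), ‖φ y‖) (.of_forall fun ω => ?_)
  refine Finset.single_le_sum (f := fun y => ‖φ y‖) (fun _ _ => norm_nonneg _) ?_
  simpa only [Fintype.mem_piFinset, Finset.mem_insert, Finset.mem_singleton]
    using fun i => hX.zero_or_one i ω

theorem memLp_two_comp (hX : IndependentIndicators μ X) (φ : (Fin n → ℕ) → ℝ) :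
    MemLp (fun ω => φ fun i => X i ω) 2 μ :=
  (memLp_two_iff_integrable_sq (hX.integrable_comp φ).aestronglyMeasurable).mpr
    (hX.integrable_comp fun y => φ y ^ 2)

variable {p : Fin n → ℝ}

theorem mean_mem_Icc (hX : IndependentIndicators μ X) (hp : ∀ i, ∫ ω, (X i ω : ℝ) ∂μ = p i)
    (i : Fin n) : p i ∈ Set.Icc (0 : ℝ) 1 := by
  have hle : ∀ ω, (X i ω : ℝ) ≤ 1 := fun ω => by
    rcases hX.zero_or_one i ω with h | h <;> simp [h]
  rw [← hp]
  refine ⟨integral_nonneg fun ω => Nat.cast_nonneg _, ?_⟩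
  simpa using integral_mono (hX.integrable_comp fun y => (y i : ℝ)) (integrable_const 1) hle

theorem variance_sum_mul (hX : IndependentIndicators μ X)
    (hp : ∀ i, ∫ ω, (X i ω : ℝ) ∂μ = p i) (c : Fin n → ℝ) :
    Var[fun ω => ∑ i, c i * (X i ω : ℝ); μ] = ∑ i, c i ^ 2 * (p i * (1 - p i)) := by
  have hvar : ∀ i, Var[fun ω => (X i ω : ℝ); μ] = p i * (1 - p i) := fun i => by
    have hsq : (fun ω => (X i ω : ℝ)) ^ 2 = fun ω => (X i ω : ℝ) := by
      ext ω
      rcases hX.zero_or_one i ω with h | h <;> simp [h]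
    rw [variance_eq_sub (hX.memLp_two_comp fun y => (y i : ℝ)), hsq, hp]
    ring
  have hsum : (fun ω => ∑ i, c i * (X i ω : ℝ)) = ∑ i, fun ω => c i * (X i ω : ℝ) := by
    ext ω
    simp
  rw [hsum, IndepFun.variance_sum (fun i _ => hX.memLp_two_comp fun y => c i * (y i : ℝ))]
  · simp only [variance_const_mul, hvar]
  · intro i _ j _ hij
    exact (hX.indep.indepFun hij).comp (φ := fun a : ℕ => c i * (a : ℝ))
      (ψ := fun a : ℕ => c j * (a : ℝ)) .of_discrete .of_discrete

theorem variance_sum (hX : IndependentIndicators μ X) (hp : ∀ i, ∫ ω, (X i ω : ℝ) ∂μ = p i) :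
    Var[fun ω => ∑ i, (X i ω : ℝ); μ] = ∑ i, p i * (1 - p i) := by
  simpa using hX.variance_sum_mul hp 1

theorem integral_sub_mul_comp_sum_erase (hX : IndependentIndicators μ X)
    (hp : ∀ i, ∫ ω, (X i ω : ℝ) ∂μ = p i) (i : Fin n) (u : ℕ → ℝ) :
    ∫ ω, ((X i ω : ℝ) - p i) * u (∑ j ∈ Finset.univ.erase i, X j ω) ∂μ = 0 := by
  have hu : Integrable (fun ω => u (∑ j ∈ Finset.univ.erase i, X j ω)) μ :=
    hX.integrable_comp fun y => u (∑ j ∈ Finset.univ.erase i, y j)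
  have hXi : Integrable (fun ω => (X i ω : ℝ) - p i) μ := hX.integrable_comp fun y => y i - p i
  have hindep : IndepFun (X i) (fun ω => ∑ j ∈ Finset.univ.erase i, X j ω) μ := by
    convert! (hX.indep.indepFun_finsetSum_of_notMem hX.measurable
      (Finset.notMem_erase i Finset.univ)).symm using 1
    ext ω
    simp
  have hprod := (hindep.comp (φ := fun a : ℕ => (a : ℝ) - p i) (ψ := u) .of_discrete
    .of_discrete).integral_fun_mul_eq_mul_integral hXi.aestronglyMeasurable
    hu.aestronglyMeasurable
  have hmean : ∫ ω, ((X i ω : ℝ) - p i) ∂μ = 0 := by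
    rw [integral_sub (hX.integrable_comp fun y => (y i : ℝ)) (integrable_const _), hp]
    simp
  refine hprod.trans ?_
  simp only [Function.comp_apply, hmean, zero_mul]

theorem integral_sub_mul_comp_sum (hX : IndependentIndicators μ X)
    (hp : ∀ i, ∫ ω, (X i ω : ℝ) ∂μ = p i) (i : Fin n) (g : ℕ → ℝ) :
    ∫ ω, ((X i ω : ℝ) - p i) * g (∑ j, X j ω) ∂μ =
      ∫ ω, p i * (1 - (X i ω : ℝ)) * (g (∑ j, X j ω + 1) - g (∑ j, X j ω)) ∂μ := by
  have hsum : ∀ ω, ∑ j, X j ω = X i ω + ∑ j ∈ Finset.univ.erase i, X j ω := fun ω =>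
    (Finset.add_sum_erase _ (fun j => X j ω) (Finset.mem_univ i)).symm
  rw [← sub_eq_zero, ← integral_sub (hX.integrable_comp fun y => (y i - p i) * g (∑ j, y j))
    (hX.integrable_comp fun y => p i * (1 - y i) * (g (∑ j, y j + 1) - g (∑ j, y j)))]
  rw [← hX.integral_sub_mul_comp_sum_erase hp i fun a => g (a + 1)]
  refine integral_congr_ae (.of_forall fun ω => ?_)
  simp only [hsum]
  rcases hX.zero_or_one i ω with h | h
  · simp only [h, Nat.cast_zero, zero_add]
    ring
  · simp only [h, Nat.cast_one, add_comm 1]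
    ring

/-- Summing over `i` turns `∑ p i (1 - X i)` into the variance minus the fluctuation
`∑ p i (X i - p i)`, whose own variance is no larger. -/
theorem integral_sum_sub_mul_comp_sum (hX : IndependentIndicators μ X)
    (hp : ∀ i, ∫ ω, (X i ω : ℝ) ∂μ = p i) (g : ℕ → ℝ) :
    ∫ ω, (((∑ i, X i ω : ℕ) : ℝ) - ∑ i, p i) * g (∑ i, X i ω) ∂μ =
      ∫ ω, (∑ i, p i * (1 - p i) - ∑ i, p i * ((X i ω : ℝ) - p i)) *
        (g (∑ i, X i ω + 1) - g (∑ i, X i ω)) ∂μ := by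
  have hfluct : ∀ ω, ∑ i, p i * (1 - p i) - ∑ i, p i * ((X i ω : ℝ) - p i) =
      ∑ i, p i * (1 - (X i ω : ℝ)) := fun ω => by
    rw [← Finset.sum_sub_distrib]
    exact Finset.sum_congr rfl fun i _ => by ring
  simp only [hfluct, Nat.cast_sum, ← Finset.sum_sub_distrib, Finset.sum_mul]
  rw [integral_finsetSum _ fun i _ => hX.integrable_comp fun y => (y i - p i) * g (∑ j, y j),
    integral_finsetSum _ fun i _ => hX.integrable_comp fun y =>
      p i * (1 - y i) * (g (∑ j, y j + 1) - g (∑ j, y j))]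
  exact Finset.sum_congr rfl fun i _ => hX.integral_sub_mul_comp_sum hp i g

theorem integral_abs_sum_mul_sub_le (hX : IndependentIndicators μ X)
    (hp : ∀ i, ∫ ω, (X i ω : ℝ) ∂μ = p i) :
    ∫ ω, |∑ i, p i * ((X i ω : ℝ) - p i)| ∂μ ≤ √(∑ i, p i * (1 - p i)) := by
  have hmean : ∫ ω, ∑ i, p i * (X i ω : ℝ) ∂μ = ∑ i, p i * p i := by
    rw [integral_finsetSum _ fun i _ => hX.integrable_comp fun y => p i * y i]
    simp only [integral_const_mul, hp]
  have hdev := integral_abs_sub_integral_le_sqrt_variance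
    (hX.memLp_two_comp fun y => ∑ i, p i * (y i : ℝ))
  rw [hmean, hX.variance_sum_mul hp] at hdev
  have hsplit : ∀ ω, ∑ i, p i * ((X i ω : ℝ) - p i) =
      ∑ i, p i * (X i ω : ℝ) - ∑ i, p i * p i := fun ω => by
    simp only [mul_sub, Finset.sum_sub_distrib]
  simp only [hsplit]
  refine hdev.trans (Real.sqrt_le_sqrt (Finset.sum_le_sum fun i _ => ?_))
  obtain ⟨hnonneg, hle_one⟩ := hX.mean_mem_Icc hp i
  exact mul_le_of_le_one_left (mul_nonneg hnonneg (sub_nonneg.mpr hle_one))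
    (pow_le_one₀ hnonneg hle_one)

theorem abs_integral_stein_operator_le (hX : IndependentIndicators μ X)
    (hp : ∀ i, ∫ ω, (X i ω : ℝ) ∂μ = p i) (r : ℝ) {g : ℕ → ℝ} {c : ℝ}
    (hg : ∀ a, |g (a + 1) - g a| ≤ c) :
    |∫ ω, (r * (g (∑ i, X i ω + 1) - g (∑ i, X i ω)) -
        (((∑ i, X i ω : ℕ) : ℝ) - ∑ i, p i) * g (∑ i, X i ω)) ∂μ| ≤
      (|r - ∑ i, p i * (1 - p i)| + √(∑ i, p i * (1 - p i))) * c := by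
  set v := ∑ i, p i * (1 - p i)
  have hc : 0 ≤ c := (abs_nonneg _).trans (hg 0)
  have hfluct : Integrable (fun ω => |∑ i, p i * ((X i ω : ℝ) - p i)|) μ :=
    hX.integrable_comp fun y => |∑ i, p i * ((y i : ℝ) - p i)|
  calc _ = |∫ ω, (r - v + ∑ i, p i * ((X i ω : ℝ) - p i)) *
          (g (∑ i, X i ω + 1) - g (∑ i, X i ω)) ∂μ| := by
        rw [integral_sub (hX.integrable_comp fun y => r * (g (∑ i, y i + 1) - g (∑ i, y i)))
          (hX.integrable_comp fun y => (((∑ i, y i : ℕ) : ℝ) - ∑ i, p i) * g (∑ i, y i)),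
          hX.integral_sum_sub_mul_comp_sum hp, ← integral_sub
          (hX.integrable_comp fun y => r * (g (∑ i, y i + 1) - g (∑ i, y i)))
          (hX.integrable_comp fun y => (v - ∑ i, p i * ((y i : ℝ) - p i)) *
            (g (∑ i, y i + 1) - g (∑ i, y i)))]
        congr 2
        ext ω
        ring
    _ ≤ ∫ ω, (|r - v| + |∑ i, p i * ((X i ω : ℝ) - p i)|) * c ∂μ := by
        rw [← Real.norm_eq_abs]
        refine norm_integral_le_of_norm_le (((integrable_const _).add hfluct).mul_const c)
          (.of_forall fun ω => ?_)
        rw [Real.norm_eq_abs, abs_mul]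
        exact mul_le_mul (abs_add_le _ _) (hg _) (abs_nonneg _) (by positivity)
    _ = (|r - v| + ∫ ω, |∑ i, p i * ((X i ω : ℝ) - p i)| ∂μ) * c := by
        rw [integral_mul_const, integral_add (integrable_const _) hfluct]
        simp
    _ ≤ (|r - v| + √v) * c := by
        gcongr
        exact hX.integral_abs_sum_mul_sub_le hp

theorem integral_sq_sum_sub (hX : IndependentIndicators μ X)
    (hp : ∀ i, ∫ ω, (X i ω : ℝ) ∂μ = p i) :
    ∫ ω, (((∑ i, X i ω : ℕ) : ℝ) - ∑ i, p i) ^ 2 ∂μ = ∑ i, p i * (1 - p i) := by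
  have hmean : ∫ ω, ∑ i, (X i ω : ℝ) ∂μ = ∑ i, p i := by
    rw [integral_finsetSum _ fun i _ => hX.integrable_comp fun y => (y i : ℝ)]
    simp only [hp]
  rw [← hX.variance_sum hp, variance_eq_integral
    (hX.integrable_comp fun y => ∑ i, (y i : ℝ)).aemeasurable, hmean]
  simp only [Nat.cast_sum]

theorem abs_measureReal_map_sum_sub_translatedPoisson_le (hX : IndependentIndicators μ X)
    (hp : ∀ i, ∫ ω, (X i ω : ℝ) ∂μ = p i) {s : ℕ} {r : NNReal} (hr : 0 < r)
    (hsr : ∑ i, p i = s + r) (A : Set ℕ) :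
    |(μ.map fun ω => ∑ i, X i ω).real A - (translatedPoisson s r).real A| ≤
      (|(r : ℝ) - ∑ i, p i * (1 - p i)| + √(∑ i, p i * (1 - p i))) / r +
        2 * (∑ i, p i * (1 - p i)) / r ^ 2 := by
  obtain ⟨g, hg, hstein⟩ := exists_translatedPoisson_stein_solution hr s A
  simp only [← hsr] at hstein
  set W : Ω → ℕ := fun ω => ∑ i, X i ω
  set P := translatedPoisson s r
  set T : ℕ → ℝ := fun a => r * (g (a + 1) - g a) - ((a : ℝ) - ∑ i, p i) * g a
  have hint : ∀ φ : ℕ → ℝ, Integrable (fun ω => φ (W ω)) μ := fun φ =>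
    hX.integrable_comp fun y => φ (∑ i, y i)
  have hlaw : (μ.map W).real A = ∫ ω, A.indicator (fun _ => (1 : ℝ)) (W ω) ∂μ := by
    rw [map_measureReal_apply hX.measurable_sum .of_discrete,
      ← integral_indicator_one (hX.measurable_sum .of_discrete)]
    rfl
  have hremainder : |∫ ω, (A.indicator (fun _ => (1 : ℝ)) (W ω) - P.real A - T (W ω)) ∂μ| ≤
      2 * (∑ i, p i * (1 - p i)) / r ^ 2 := calc
    _ = ‖∫ ω, (A.indicator (fun _ => (1 : ℝ)) (W ω) - P.real A - T (W ω)) ∂μ‖ := rfl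
    _ ≤ ∫ ω, 2 * (((W ω : ℝ) - ∑ i, p i) / r) ^ 2 ∂μ :=
      norm_integral_le_of_norm_le (hint fun a => 2 * (((a : ℝ) - ∑ i, p i) / r) ^ 2)
        (.of_forall fun ω => hstein (W ω))
    _ = 2 * (∑ i, p i * (1 - p i)) / r ^ 2 := by
      simp only [div_pow, integral_const_mul, integral_div, W, hX.integral_sq_sum_sub hp,
        mul_div_assoc]
  have hsplit : (μ.map W).real A - P.real A = ∫ ω, T (W ω) ∂μ +
      ∫ ω, (A.indicator (fun _ => (1 : ℝ)) (W ω) - P.real A - T (W ω)) ∂μ := by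
    rw [integral_sub (hint fun a => A.indicator (fun _ => (1 : ℝ)) a - P.real A) (hint T),
      integral_sub (hint _) (integrable_const _), hlaw]
    simp
  rw [hsplit]
  refine (abs_add_le _ _).trans (add_le_add ?_ hremainder)
  rw [div_eq_mul_one_div]
  exact hX.abs_integral_stein_operator_le hp r hg

theorem exists_tvDist_translatedPoisson_le (hX : IndependentIndicators μ X) :
    ∃ (s : ℕ) (r : NNReal), tvDist (μ.map fun ω => ∑ i, X i ω) (translatedPoisson s r) ≤
      6 / √(1 + Var[fun ω => ∑ i, (X i ω : ℝ); μ]) := by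
  have : IsProbabilityMeasure (μ.map fun ω => ∑ i, X i ω) :=
    Measure.isProbabilityMeasure_map hX.measurable_sum.aemeasurable
  have hvar := variance_nonneg (fun ω => ∑ i, (X i ω : ℝ)) μ
  set p : Fin n → ℝ := fun i => ∫ ω, (X i ω : ℝ) ∂μ
  have hp : ∀ i, ∫ ω, (X i ω : ℝ) ∂μ = p i := fun _ => rfl
  rw [hX.variance_sum hp] at hvar ⊢
  set v := ∑ i, p i * (1 - p i)
  rcases lt_or_ge v 1 with hv | hv
  · have hone : 1 ≤ 6 / √(1 + v) := by
      rw [one_le_div (Real.sqrt_pos.mpr (by linarith))]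
      exact Real.sqrt_le_iff.mpr ⟨by norm_num, by linarith⟩
    exact ⟨0, 1, (tvDist_le_one _ _).trans hone⟩
  · -- The largest translation `s` for which the Poisson mean `r = m - s` is still at least `v`.
    set m := ∑ i, p i
    have hvm : v ≤ m := Finset.sum_le_sum fun i _ => by nlinarith [sq_nonneg (p i)]
    set s := ⌊m - v⌋₊
    have hs : (s : ℝ) ≤ m - v := Nat.floor_le (sub_nonneg.mpr hvm)
    have hs' : m - v < s + 1 := Nat.lt_floor_add_one _
    obtain ⟨r, hr⟩ : ∃ r : NNReal, (r : ℝ) = m - s :=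
      ⟨(m - s).toNNReal, Real.coe_toNNReal _ (by linarith)⟩
    have hvr : v ≤ r := by linarith
    have hrpos : (0 : ℝ) < r := by linarith
    refine ⟨s, r, tvDist_le_of_forall_abs_measureReal_sub_le fun A =>
      (hX.abs_measureReal_map_sum_sub_translatedPoisson_le hp (by exact_mod_cast hrpos)
        (by linarith) A).trans ?_⟩
    calc (|(r : ℝ) - v| + √v) / r + 2 * v / r ^ 2 ≤ (1 + √v) / v + 2 * v / v ^ 2 := by
          gcongr
          exact abs_le.mpr ⟨by linarith, by linarith⟩
      _ ≤ 6 / √(1 + v) := one_add_sqrt_div_add_le hv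

end IndependentIndicators

theorem IsHeavyBinomialForm.le_sum_mul_one_sub {k n : ℕ} {p : Fin n → ℝ}
    (hp : IsHeavyBinomialForm k p) :
    (k : ℝ) ^ 2 - k - 1 - 3 / k ≤ ∑ i, p i * (1 - p i) := by
  obtain ⟨ℓ, q, hℓ, -, hlt, hge, -, hvar⟩ := hp
  have hterm : ∀ i : Fin n, p i * (1 - p i) = if (i : ℕ) < ℓ then q * (1 - q) else 0 := fun i => by
    split_ifs with hi
    · rw [hlt i hi]
    · rcases hge i (not_lt.mp hi) with h | h <;> simp [h]
  calc (k : ℝ) ^ 2 - k - 1 - 3 / k ≤ ℓ * q * (1 - q) := hvar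
    _ = ∑ i, p i * (1 - p i) := by
      rw [Finset.sum_congr rfl fun i _ => hterm i, Finset.sum_ite, Finset.sum_const_zero, add_zero,
        Finset.sum_const, Fin.card_filter_val_lt, min_eq_right hℓ, nsmul_eq_mul, mul_assoc]

theorem HeavyBinomialCollection.half_le_sqrt_one_add_variance {Ω : Type*} [MeasurableSpace Ω]
    {μ : Measure Ω} [IsProbabilityMeasure μ] {k n : ℕ} {X : Fin n → Ω → ℕ}
    (hX : HeavyBinomialCollection μ k X) :
    (k : ℝ) / 2 ≤ √(1 + Var[fun ω => ∑ i, (X i ω : ℝ); μ]) := by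
  refine Real.le_sqrt_of_sq_le ?_
  rcases le_or_gt k 2 with hk | hk
  · have hk' : (k : ℝ) ≤ 2 := by exact_mod_cast hk
    have hvar := variance_nonneg (fun ω => ∑ i, (X i ω : ℝ)) μ
    have hsq : ((k : ℝ) / 2) ^ 2 ≤ 1 := pow_le_one₀ (by positivity) (by linarith)
    linarith
  · have hk' : (3 : ℝ) ≤ k := by exact_mod_cast hk
    have hdiv : 3 / (k : ℝ) ≤ 1 := (div_le_one (by linarith)).mpr hk'
    have hheavy := hX.heavy.le_sum_mul_one_sub
    rw [← hX.indicators.variance_sum fun _ => rfl] at hheavy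
    nlinarith

end PoissonBinomial

open PoissonBinomial in
theorem mainTheorem9_general {Ω Ω' : Type*} [MeasurableSpace Ω] {μ : Measure Ω}
    [IsProbabilityMeasure μ] [MeasurableSpace Ω'] {ν : Measure Ω'} [IsProbabilityMeasure ν]
    {m n : ℕ} {X : Fin m → Ω → ℕ} {Y : Fin n → Ω' → ℕ} (hX : IndependentIndicators μ X)
    (hY : IndependentIndicators ν Y) :
    dK μ (fun ω => ∑ i, X i ω) ν (fun ω => ∑ i, Y i ω) ≤
        dTV μ (fun ω => ∑ i, X i ω) ν (fun ω => ∑ i, Y i ω) ∧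
      dTV μ (fun ω => ∑ i, X i ω) ν (fun ω => ∑ i, Y i ω) ≤
        2 * dK μ (fun ω => ∑ i, X i ω) ν (fun ω => ∑ i, Y i ω) +
          12 / √(1 + Var[fun ω => ∑ i, (X i ω : ℝ); μ]) +
          12 / √(1 + Var[fun ω => ∑ i, (Y i ω : ℝ); ν]) := by
  have : IsProbabilityMeasure (μ.map fun ω => ∑ i, X i ω) :=
    Measure.isProbabilityMeasure_map hX.measurable_sum.aemeasurable
  have : IsProbabilityMeasure (ν.map fun ω => ∑ i, Y i ω) :=
    Measure.isProbabilityMeasure_map hY.measurable_sum.aemeasurable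
  obtain ⟨s, r, hXTP⟩ := hX.exists_tvDist_translatedPoisson_le
  obtain ⟨t, u, hYTP⟩ := hY.exists_tvDist_translatedPoisson_le
  rw [dK_eq_natKolmogorovDist μ ν hX.measurable_sum hY.measurable_sum]
  refine ⟨natKolmogorovDist_le_tvDist _ _,
    (tvDist_le_two_mul_natKolmogorovDist_add _ _ s t r u).trans ?_⟩
  linear_combination 2 * hXTP + 2 * hYTP

theorem mainTheorem9 :
    ∃ C : ℝ, 0 < C ∧
      ∀ (k n : ℕ), 1 ≤ k →
      ∀ (Ω : Type*) [MeasurableSpace Ω] (μ : Measure Ω) [IsProbabilityMeasure μ]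
        (Ω' : Type*) [MeasurableSpace Ω'] (ν : Measure Ω') [IsProbabilityMeasure ν]
        (X : Fin n → Ω → ℕ) (Y : Fin n → Ω' → ℕ),
        PoissonBinomial.HeavyBinomialCollection μ k X →
        PoissonBinomial.HeavyBinomialCollection ν k Y →
        (1 / 2 : ℝ) * PoissonBinomial.dK μ (fun ω => ∑ i, X i ω) ν (fun ω => ∑ i, Y i ω) ≤
            PoissonBinomial.dTV μ (fun ω => ∑ i, X i ω) ν (fun ω => ∑ i, Y i ω) ∧
          PoissonBinomial.dTV μ (fun ω => ∑ i, X i ω) ν (fun ω => ∑ i, Y i ω) ≤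
            2 * PoissonBinomial.dK μ (fun ω => ∑ i, X i ω) ν (fun ω => ∑ i, Y i ω) +
              C / (k : ℝ) := by
  refine ⟨48, by norm_num, fun k n hk Ω _ μ _ Ω' _ ν _ X Y hX hY => ?_⟩
  have hk' : (0 : ℝ) < k / 2 := half_pos (Nat.cast_pos.mpr hk)
  have hdK : 0 ≤ PoissonBinomial.dK μ (fun ω => ∑ i, X i ω) ν (fun ω => ∑ i, Y i ω) :=
    PoissonBinomial.kolmogorovDist_nonneg _ _
  obtain ⟨hlower, hupper⟩ := mainTheorem9_general hX.indicators hY.indicators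
  have hXk := div_le_div_of_nonneg_left (by norm_num : (0 : ℝ) ≤ 12) hk'
    hX.half_le_sqrt_one_add_variance
  have hYk := div_le_div_of_nonneg_left (by norm_num : (0 : ℝ) ≤ 12) hk'
    hY.half_le_sqrt_one_add_variance
  exact ⟨by linarith, by linear_combination hupper + hXk + hYk⟩
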